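/- Let $(S,d_S)$ be a separable metric space with the Radon property (every Borel probability measure $\mu$ on $S$ satisfies $\mu(B)=\sup\{\mu(K): K\subseteq B \text{ compact}\}$ for all Borel $B$). Write $[S]$ for the space of Borel probability measures on $S$ with the topology of weak convergence and its Borel $\sigma$-algebra. For $p\ge 1$ let $[S]_p\subseteq[S]$ be the set of those $\mu$ with $\int d_S(x,x_0)^p\,\mu(dx)<\infty$ for some $x_0\in S$, with the $p$-Wasserstein distance $$d^{(p)}_{[S]}(\mu,\nu)=\inf_\gamma\Big(\int_{S^2} d_S(x,y)^p\,\gamma(dx\,dy)\Big)^{1/p},$$ the infimum being over all probability measures $\gamma$ on $S^2$ with marginals $\mu$ and $\nu$. Let $d^{(p)}_{[[S]_p]}$ be the $p$-Wasserstein distance, defined in the same way, between probability measures on the metric space $([S]_p,d^{(p)}_{[S]})$. Let $\rho$ be a probability measure on $S^\infty$ under which the coordinates $\tilde\xi_1,\tilde\xi_2,\dots$ are exchangeable, put $\tilde\xi^{(n)}=(\tilde\xi_1,\dots,\tilde\xi_n)$, and let $\tilde{\mathfrak p}:S^\infty\to[S]$ be the directing random measure, i.e. a random probability measure such that $\frac1n\sum_{i=1}^n\delta_{\tilde\xi_i}\to\tilde{\mathfrak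 p}$ weakly, $\rho$-almost surely. For $n\ge1$ let the posterior $\pi(\tilde\xi^{(n)})=\pi(\tilde\xi^{(n)},\cdot)$ be a regular conditional distribution of $\tilde{\mathfrak p}$ given $\tilde\xi^{(n)}$ under $\rho$, and let $\hat{\mathfrak p}_n$ be a random element of $[S]_p$ that is measurable with respect to the $\sigma$-algebra generated by $\tilde\xi^{(n)}$. Assume that $\tilde{\mathfrak p}\in[S]_p$ $\rho$-almost surely. Let $(b_n)_{n\ge1}$ be a nondecreasing sequence of positive numbers with $b_n\to\infty$, and let $C_p,Y_p:[S]\to[0,\infty)$ be functions such that $C_p(\tilde{\mathfrak p})$ and $Y_p(\tilde{\mathfrak p})$ are real random variables. Suppose that, for $\rho$-almost every value $\mathfrak p$ of $\tilde{\mathfrak p}$, the law $\mathfrak p^\infty$ on $S^\infty$ (under which the coordinates are i.i.d. with law $\mathfrak p$) satisfies $$\mathfrak p^\infty\Big[\Big(\sup_{n\ge1} b_n\, d^{(p)}_{[S]}(\mathfrak p,\hat{\mathfrak p}_n)\Big)^p\Big]\le C_p(\mathfrak p)\qquad\text{and}\qquad \mathfrak p^\infty\Big(\limsup_{n\to\infty}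 b_n\, d^{(p)}_{[S]}(\mathfrak p,\hat{\mathfrak p}_n)\le Y_p(\mathfrak p)\Big)=1,$$ where $\mathfrak p^\infty[X]$ denotes the expectation of $X$ under $\mathfrak p^\infty$. If $\rho[C_p(\tilde{\mathfrak p})]<\infty$, then $$\rho\Big(\limsup_{n\to\infty} b_n\, d^{(p)}_{[[S]_p]}\big(\pi(\tilde\xi^{(n)}),\delta_{\hat{\mathfrak p}_n}\big)\le Y_p(\tilde{\mathfrak p})\Big)=1 .$$ -/

import Mathlib

open MeasureTheory ProbabilityTheory Filter Topology
open scoped ENNReal NNReal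

namespace PosteriorWasserstein

/-- Radon property: every Borel probability measure on `S` has the compact inner approximation
property, i.e. `μ B = sup {μ K | K ⊆ B compact}` for all Borel sets `B`. -/
def IsRadonSpace (S : Type*) [TopologicalSpace S] [MeasurableSpace S] : Prop :=
  ∀ μ : ProbabilityMeasure S, (μ : Measure S).InnerRegularWRT IsCompact MeasurableSet

/-- Probability measures on `X × X` with first marginal `μ` and second marginal `ν`. -/
def couplings {X : Type*} [MeasurableSpace X] (μ ν : Measure X) : Set (Measure (X × X)) :=
  {γ | IsProbabilityMeasure γ ∧ γ.map Prod.fst = μ ∧ γ.map Prod.snd = ν}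

/-- The `p`-Wasserstein distance built on a distance function `d` on `X`:
`inf_γ (∫ d(x, y)^p γ(dx dy))^(1/p)` over all couplings `γ` of `μ` and `ν`,
with values in `[0, ∞]`. -/
noncomputable def wassersteinDist {X : Type*} [MeasurableSpace X] (d : X → X → ℝ≥0∞) (p : ℝ)
    (μ ν : Measure X) : ℝ≥0∞ :=
  ⨅ γ ∈ couplings μ ν, (∫⁻ z, d z.1 z.2 ^ p ∂γ) ^ (1 / p)

/-- The set of Borel probability measures on `S` with a finite `p`-th moment. -/
def finiteMoment (S : Type*) [MetricSpace S] [MeasurableSpace S] (p : ℝ) :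
    Set (ProbabilityMeasure S) :=
  {μ | ∃ x₀ : S, ∫⁻ x, edist x x₀ ^ p ∂(μ : Measure S) < ∞}

/-- The space `[S]_p` of Borel probability measures on `S` with a finite `p`-th moment.
Its σ-algebra is the trace of the σ-algebra of `ProbabilityMeasure S` (generated by the evaluations
`μ ↦ μ B`). On a separable metric space the latter is the Borel σ-algebra of weak convergence,
and if moreover `S` has the Radon property, then the trace is the Borel σ-algebra of the
`p`-Wasserstein distance on `[S]_p`. -/
abbrev WassersteinSpace (S : Type*) [MetricSpace S] [MeasurableSpace S] (p : ℝ) : Type _ :=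
  finiteMoment S p

/-- The `p`-Wasserstein distance between probability measures on the metric space `S`. -/
noncomputable def dist₁ {S : Type*} [MetricSpace S] [MeasurableSpace S] (p : ℝ)
    (μ ν : ProbabilityMeasure S) : ℝ≥0∞ :=
  wassersteinDist (fun x y : S => edist x y) p (μ : Measure S) (ν : Measure S)

/-- The `p`-Wasserstein distance between measures on the space `[S]_p`, which is itself endowed
with the `p`-Wasserstein distance. -/
noncomputable def dist₂ {S : Type*} [MetricSpace S] [MeasurableSpace S] (p : ℝ)
    (P Q : Measure (WassersteinSpace S p)) : ℝ≥0∞ :=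
  wassersteinDist (fun μ ν : WassersteinSpace S p => dist₁ p μ.1 ν.1) p P Q

/-- The sample `ξ^(n)`: the first `n` coordinates of a sequence. -/
def sample {S : Type*} (n : ℕ) (ω : ℕ → S) : Fin n → S := fun i => ω i

/-- The σ-algebra on the sequence space that is generated by `ξ^(n)`. -/
abbrev sampleSigma (S : Type*) [MeasurableSpace S] (n : ℕ) : MeasurableSpace (ℕ → S) :=
  MeasurableSpace.comap (sample n) inferInstance

/-- Exchangeability of the coordinates under `ρ`: the joint law of any `n` distinct coordinates
depends only on `n`. -/
def Exchangeable {S : Type*} [MeasurableSpace S] (ρ : Measure (ℕ → S)) : Prop :=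
  ∀ (n : ℕ) (f : Fin n → ℕ), Function.Injective f →
    ρ.map (fun ω i => ω (f i)) = ρ.map (sample n)

/-- The empirical measure `(1/(n+1)) ∑_{i ≤ n} δ_{ω i}` of the first `n + 1` coordinates. -/
noncomputable def empiricalMeasure {S : Type*} [MeasurableSpace S] (n : ℕ) (ω : ℕ → S) :
    ProbabilityMeasure S :=
  ⟨((n + 1 : ℕ) : ℝ≥0∞)⁻¹ • ∑ i ∈ Finset.range (n + 1), Measure.dirac (ω i), ⟨by
    simp only [Measure.smul_apply, Measure.finsetSum_apply, measure_univ, Finset.sum_const,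
      Finset.card_range, nsmul_eq_mul, mul_one, smul_eq_mul]
    exact ENNReal.inv_mul_cancel (by simp) (ENNReal.natCast_ne_top _)⟩⟩

/-- `P` is the directing random measure of the coordinates under `ρ`: a random probability measure
to which the empirical measures converge weakly, `ρ`-almost surely. -/
def IsDirectingMeasure {S : Type*} [TopologicalSpace S] [MeasurableSpace S]
    [OpensMeasurableSpace S] (ρ : Measure (ℕ → S)) (P : (ℕ → S) → ProbabilityMeasure S) : Prop :=
  Measurable P ∧ ∀ᵐ ω ∂ρ, Tendsto (fun n => empiricalMeasure n ω) atTop (𝓝 (P ω))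

/-- `κ` is a posterior distribution given `ξ^(n)`: a regular conditional distribution of the
random measure `P`, i.e. `κ(ξ^(n), B)` is a version of `ρ(P ∈ B | ξ^(n))` for all measurable `B`. -/
def IsPosterior {S : Type*} [MeasurableSpace S] (ρ : Measure (ℕ → S))
    (P : (ℕ → S) → ProbabilityMeasure S) (n : ℕ)
    (κ : Kernel (Fin n → S) (ProbabilityMeasure S)) : Prop :=
  IsMarkovKernel κ ∧ ∀ B : Set (ProbabilityMeasure S), MeasurableSet B →
    (fun ω => (κ (sample n ω)).real B) =ᵐ[ρ] ρ⟦P ⁻¹' B | sampleSigma S n⟧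

/-- The measure on `[S]_p` induced by a measure on the space of all probability measures on `S`
(with total mass one if the latter is a probability measure that is concentrated on `[S]_p`). -/
noncomputable def onWassersteinSpace {S : Type*} [MetricSpace S] [MeasurableSpace S] (p : ℝ)
    (Q : Measure (ProbabilityMeasure S)) : Measure (WassersteinSpace S p) :=
  Q.comap Subtype.val

/-- The law on the sequence space under which the coordinates are i.i.d. with law `μ`. -/
noncomputable def iidLaw {S : Type*} [MeasurableSpace S] (μ : ProbabilityMeasure S) :
    Measure (ℕ → S) :=
  Measure.infinitePi (fun _ : ℕ => (μ : Measure S))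

/-- The uniform moment bound: if the coordinates are i.i.d. with law `μ`, then
`E[(sup_{n ≥ 1} b_n W_p(μ, p̂_n))^p] ≤ c`. -/
def UniformMomentBound {S : Type*} [MetricSpace S] [MeasurableSpace S] (p : ℝ) (b : ℕ → ℝ)
    (phat : ℕ → (ℕ → S) → WassersteinSpace S p) (μ : ProbabilityMeasure S) (c : ℝ≥0) : Prop :=
  ∫⁻ ω, (⨆ n ≥ 1, ENNReal.ofReal (b n) * dist₁ p μ (phat n ω).1) ^ p ∂(iidLaw μ) ≤ c

/-- The almost-sure bound: if the coordinates are i.i.d. with law `μ`, then almost surely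
`limsup_n b_n W_p(μ, p̂_n) ≤ y`. -/
def AlmostSureBound {S : Type*} [MetricSpace S] [MeasurableSpace S] (p : ℝ) (b : ℕ → ℝ)
    (phat : ℕ → (ℕ → S) → WassersteinSpace S p) (μ : ProbabilityMeasure S) (y : ℝ≥0) : Prop :=
  ∀ᵐ ω ∂(iidLaw μ),
    limsup (fun n => ENNReal.ofReal (b n) * dist₁ p μ (phat n ω).1) atTop ≤ y

end PosteriorWasserstein

open scoped BoundedContinuousFunction

set_option linter.unusedSectionVars false

/-! Coupling the posterior `π_n` with a Dirac mass by the product measure gives `W_p(π_n,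
δ_{p̂_n})^p ≤ ∫ W_p(μ, p̂_n)^p π_n(dμ)` (`dist₂_dirac_le`). As `p̂_n` is a function of the sample,
the right side is a version of the conditional expectation of `W_p(P, p̂_n)^p` given `ξ^(n)`. With
`X_n = (b_n W_p(P, p̂_n))^p` and `𝓕_n = σ(ξ^(n))` it remains to see that `limsup E[X_n | 𝓕_n] ≤
limsup X_n ≤ Y(P)^p` almost surely.

The first inequality is Hunt's lemma (`limsup_posterior_lintegral_le`): for `n ≥ m` the variable
`X_n` is below the tail supremum `V_m`, and `E[V_m | 𝓕_n] → V_m` by Lévy's upward theorem, because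
the whole sequence determines `V_m`; then `m → ∞`. This requires `sup X_n` to be integrable.

That integrability and the second inequality are assumed under the i.i.d. laws only. De Finetti's
theorem (`map_directing_prodMk_eq`) carries both over to `ρ`: given `P`, the coordinates are i.i.d.
with law `P`. It is derived from the convergence of the empirical measures and the invariance of `P`
under exchanges of coordinates.

All of this needs `W_p` to be jointly measurable on `[S]_p`. It is there the limit of transport
costs between finite quantizations (`measurableDist_eq_dist₁`). -/

namespace PosteriorWasserstein

/-! ### Measurability of finite optimal transport costs -/

section FiniteTransport

variable {E : Type*} [Fintype E]

/-- The matrices with prescribed row and column sums. -/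
def transportPlans (m m' : E → ℝ≥0) : Set (E × E → ℝ≥0) :=
  {g | (∀ i, ∑ j, g (i, j) = m i) ∧ ∀ j, ∑ i, g (i, j) = m' j}

/-- The `1/p`-th power of the optimal transport cost between two mass vectors on a finite set. -/
noncomputable def transportCost (p : ℝ) (c : E × E → ℝ≥0) (m m' : E → ℝ≥0) : ℝ≥0∞ :=
  ⨅ g ∈ transportPlans m m', ((∑ z, g z * c z : ℝ≥0) : ℝ≥0∞) ^ (1 / p)

lemma measurableSet_of_isSigmaCompact {X : Type*} [TopologicalSpace X] [T2Space X]
    [MeasurableSpace X] [OpensMeasurableSpace X] {s : Set X} (hs : IsSigmaCompact s) :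
    MeasurableSet s := by
  obtain ⟨K, hK, rfl⟩ := hs
  exact MeasurableSet.iUnion fun n => (hK n).measurableSet

/-- A strict sublevel set is the image, under the continuous map from a matrix to its two marginals,
of an open set of matrices. Open sets in this σ-compact metrizable space are countable unions of
closed, hence σ-compact, sets, so the image is σ-compact and therefore Borel. -/
lemma measurable_transportCost (p : ℝ) (c : E × E → ℝ≥0) :
    Measurable fun x : (E → ℝ≥0) × (E → ℝ≥0) => transportCost p c x.1 x.2 := by
  refine measurable_of_Iio fun t => ?_
  let f : (E × E → ℝ≥0) → ℝ≥0∞ := fun g => ((∑ z, g z * c z : ℝ≥0) : ℝ≥0∞) ^ (1 / p)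
  let marg : (E × E → ℝ≥0) → (E → ℝ≥0) × (E → ℝ≥0) :=
    fun g => (fun i => ∑ j, g (i, j), fun j => ∑ i, g (i, j))
  have hf : Continuous f := ENNReal.continuous_rpow_const.comp
    (ENNReal.continuous_coe.comp (by fun_prop))
  have hmarg : Continuous marg := by fun_prop
  have heq : (fun x : (E → ℝ≥0) × (E → ℝ≥0) => transportCost p c x.1 x.2) ⁻¹' Set.Iio t =
      marg '' (f ⁻¹' Set.Iio t) := by
    ext x
    simp only [transportCost, Set.mem_preimage, Set.mem_Iio, iInf_lt_iff, Set.mem_image]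
    constructor
    · rintro ⟨g, hg, hlt⟩
      exact ⟨g, hlt, Prod.ext (funext hg.1) (funext hg.2)⟩
    · rintro ⟨g, hlt, rfl⟩
      exact ⟨g, ⟨fun i => rfl, fun j => rfl⟩, hlt⟩
  rw [heq]
  obtain ⟨F, hF, -, hU, -⟩ :=
    (isOpen_Iio.preimage hf : IsOpen (f ⁻¹' Set.Iio t)).exists_iUnion_isClosed
  rw [← hU, Set.image_iUnion]
  exact MeasurableSet.iUnion fun n => measurableSet_of_isSigmaCompact
    ((isSigmaCompact_univ.of_isClosed_subset (hF n) (Set.subset_univ _)).image hmarg)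

end FiniteTransport

/-! ### Couplings on `S` versus transport plans between cells -/

section Discretization

variable {S E : Type*} [MeasurableSpace S] [Fintype E] [MeasurableSpace E]
  [MeasurableSingletonClass E]

/-- The masses of the cells of a finite partition. -/
noncomputable def cellMass (T : S → E) (μ : ProbabilityMeasure S) : E → ℝ≥0 :=
  fun i => μ (T ⁻¹' {i})

lemma measurable_cellMass {T : S → E} (hT : Measurable T) : Measurable (cellMass T) := by
  refine measurable_pi_lambda _ fun i => ?_
  exact ((Measure.measurable_coe (hT (measurableSet_singleton i))).comp
    measurable_subtype_coe).ennreal_toNNReal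

lemma coe_cellMass (T : S → E) (μ : ProbabilityMeasure S) (i : E) :
    (cellMass T μ i : ℝ≥0∞) = (μ : Measure S) (T ⁻¹' {i}) := by
  simp [cellMass]

lemma sum_measure_inter_preimage {X : Type*} [MeasurableSpace X] (μ : Measure X) {T : X → E}
    (hT : Measurable T) (B : Set X) (hB : MeasurableSet B) :
    ∑ i, μ (T ⁻¹' {i} ∩ B) = μ B := by
  rw [← measure_biUnion_finset]
  · congr 1; ext x; simp
  · intro i _ j _ hij
    refine Set.disjoint_left.2 fun x hx hx' => hij ?_
    exact hx.1.symm.trans hx'.1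
  · exact fun i _ => (hT (measurableSet_singleton i)).inter hB

/-- The coupling that transports mass between cells according to a matrix, and independently
within the cells. -/
noncomputable def liftPlan (T : S → E) (μ ν : Measure S) (g : E × E → ℝ≥0) : Measure (S × S) :=
  ∑ z : E × E, g z • (μ[|T ⁻¹' {z.1}]).prod (ν[|T ⁻¹' {z.2}])

/-- Conditioning on a null set yields the zero measure, so the weight must vanish on null cells for
no mass to be lost. -/
lemma mul_cond_univ {ν : Measure S} [IsFiniteMeasure ν] {s : Set S} {a : ℝ≥0}
    (h : ν s = 0 → a = 0) : (a : ℝ≥0∞) * ν[|s] Set.univ = a := by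
  by_cases hs : ν s = 0
  · simp [h hs]
  · have := cond_isProbabilityMeasure hs
    simp

lemma plan_eq_zero_left {T : S → E} {μ ν : ProbabilityMeasure S} {g : E × E → ℝ≥0}
    (hg : g ∈ transportPlans (cellMass T μ) (cellMass T ν)) (z : E × E)
    (h : (μ : Measure S) (T ⁻¹' {z.1}) = 0) : g z = 0 := by
  have h1 : cellMass T μ z.1 = 0 := by rw [← ENNReal.coe_eq_zero, coe_cellMass, h]
  rw [← hg.1 z.1, Finset.sum_eq_zero_iff] at h1
  exact h1 z.2 (Finset.mem_univ _)

lemma plan_eq_zero_right {T : S → E} {μ ν : ProbabilityMeasure S} {g : E × E → ℝ≥0}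
    (hg : g ∈ transportPlans (cellMass T μ) (cellMass T ν)) (z : E × E)
    (h : (ν : Measure S) (T ⁻¹' {z.2}) = 0) : g z = 0 := by
  have h1 : cellMass T ν z.2 = 0 := by rw [← ENNReal.coe_eq_zero, coe_cellMass, h]
  rw [← hg.2 z.2, Finset.sum_eq_zero_iff] at h1
  exact h1 z.1 (Finset.mem_univ _)

lemma sum_mass_mul_cond (μ : ProbabilityMeasure S) {T : S → E} (hT : Measurable T) {B : Set S}
    (hB : MeasurableSet B) :
    ∑ i, (cellMass T μ i : ℝ≥0∞) * (μ : Measure S)[B | T ⁻¹' {i}] = (μ : Measure S) B := by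
  rw [← sum_measure_inter_preimage (μ : Measure S) hT B hB]
  refine Finset.sum_congr rfl fun i _ => ?_
  rw [coe_cellMass, mul_comm, cond_mul_eq_inter (hT (measurableSet_singleton i))]

lemma liftPlan_mem_couplings {T : S → E} (hT : Measurable T) {μ ν : ProbabilityMeasure S}
    {g : E × E → ℝ≥0} (hg : g ∈ transportPlans (cellMass T μ) (cellMass T ν)) :
    liftPlan T μ ν g ∈ couplings (μ : Measure S) (ν : Measure S) := by
  have h1 : (liftPlan T μ ν g).map Prod.fst = μ := by
    ext B hB
    rw [Measure.map_apply measurable_fst hB, ← Set.prod_univ]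
    simp only [liftPlan, Measure.finsetSum_apply, Measure.smul_apply, Measure.prod_prod]
    rw [← sum_mass_mul_cond μ hT hB, Fintype.sum_prod_type]
    refine Finset.sum_congr rfl fun i _ => ?_
    rw [← hg.1 i, ENNReal.ofNNReal_finsetSum, Finset.sum_mul]
    refine Finset.sum_congr rfl fun j _ => ?_
    rw [ENNReal.smul_def, smul_eq_mul, mul_left_comm,
      mul_cond_univ (plan_eq_zero_right hg (i, j)), mul_comm]
  have h2 : (liftPlan T μ ν g).map Prod.snd = ν := by
    ext B hB
    rw [Measure.map_apply measurable_snd hB, ← Set.univ_prod]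
    simp only [liftPlan, Measure.finsetSum_apply, Measure.smul_apply, Measure.prod_prod]
    rw [← sum_mass_mul_cond ν hT hB, Fintype.sum_prod_type_right]
    refine Finset.sum_congr rfl fun j _ => ?_
    rw [← hg.2 j, ENNReal.ofNNReal_finsetSum, Finset.sum_mul]
    refine Finset.sum_congr rfl fun i _ => ?_
    rw [ENNReal.smul_def, smul_eq_mul, ← mul_assoc,
      mul_cond_univ (plan_eq_zero_left hg (i, j))]
  refine ⟨⟨?_⟩, h1, h2⟩
  rw [← Set.preimage_univ (f := Prod.fst), ← Measure.map_apply measurable_fst .univ, h1,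
    measure_univ]

lemma ae_cond_prod_mem {μ ν : Measure S} [IsFiniteMeasure μ] [IsFiniteMeasure ν]
    {A B : Set S} (hA : MeasurableSet A) (hB : MeasurableSet B) :
    ∀ᵐ x ∂(μ[|A]).prod (ν[|B]), x.1 ∈ A ∧ x.2 ∈ B := by
  have h1 : ∀ᵐ x ∂(μ[|A]), x ∈ A := ae_cond_mem hA
  have h2 : ∀ᵐ x ∂(ν[|B]), x ∈ B := ae_cond_mem hB
  exact (Measure.quasiMeasurePreserving_fst.ae h1).and (Measure.quasiMeasurePreserving_snd.ae h2)

/-- The cost is constant on products of cells. Only an inequality is claimed, since `g` is arbitrary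
and its weight on null cells is lost in the lift. -/
lemma lintegral_liftPlan_le {T : S → E} (hT : Measurable T) (μ ν : ProbabilityMeasure S)
    (g : E × E → ℝ≥0) (c : E × E → ℝ≥0) :
    ∫⁻ z, c (T z.1, T z.2) ∂(liftPlan T μ ν g) ≤ ((∑ z, g z * c z : ℝ≥0) : ℝ≥0∞) := by
  rw [liftPlan, lintegral_finsetSum_measure, ENNReal.ofNNReal_finsetSum]
  refine Finset.sum_le_sum fun z _ => ?_
  rw [lintegral_smul_measure, ENNReal.smul_def, smul_eq_mul, ENNReal.coe_mul]
  gcongr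
  have hae := ae_cond_prod_mem (μ := (μ : Measure S)) (ν := (ν : Measure S))
    (hT (measurableSet_singleton z.1)) (hT (measurableSet_singleton z.2))
  rw [lintegral_congr_ae (g := fun _ => (c z : ℝ≥0∞))]
  · rw [lintegral_const, ← Set.univ_prod_univ, Measure.prod_prod]
    have h1 : ∀ (κ : ProbabilityMeasure S) (s : Set S), (κ : Measure S)[|s] Set.univ ≤ 1 := by
      intro κ s
      by_cases hs : (κ : Measure S) s = 0
      · simp [cond_eq_zero_of_meas_eq_zero hs]
      · have := cond_isProbabilityMeasure hs
        simp
    calc _ ≤ (c z : ℝ≥0∞) * (1 * 1) := by gcongr <;> apply h1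
      _ = c z := by simp
  · filter_upwards [hae] with x hx
    have e1 : T x.1 = z.1 := hx.1
    have e2 : T x.2 = z.2 := hx.2
    simp [e1, e2]

lemma map_mem_transportPlans {T : S → E} (hT : Measurable T) {μ ν : ProbabilityMeasure S}
    {γ : Measure (S × S)} (hγ : γ ∈ couplings (μ : Measure S) (ν : Measure S)) :
    (fun z => (γ ((fun x => (T x.1, T x.2)) ⁻¹' {z})).toNNReal) ∈
      transportPlans (cellMass T μ) (cellMass T ν) := by
  obtain ⟨hp, h1, h2⟩ := hγ
  have hfin : ∀ s, γ s ≠ ∞ := measure_ne_top γ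
  constructor
  · intro i
    rw [← ENNReal.coe_inj, ENNReal.ofNNReal_finsetSum, coe_cellMass, ← h1,
      Measure.map_apply measurable_fst (hT (measurableSet_singleton i)),
      ← sum_measure_inter_preimage γ (hT.comp measurable_snd) _
        (measurable_fst (hT (measurableSet_singleton i)))]
    refine Finset.sum_congr rfl fun j _ => ?_
    rw [ENNReal.coe_toNNReal (hfin _)]
    congr 1; ext x; simp [and_comm]
  · intro j
    rw [← ENNReal.coe_inj, ENNReal.ofNNReal_finsetSum, coe_cellMass, ← h2,
      Measure.map_apply measurable_snd (hT (measurableSet_singleton j)),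
      ← sum_measure_inter_preimage γ (hT.comp measurable_fst) _
        (measurable_snd (hT (measurableSet_singleton j)))]
    refine Finset.sum_congr rfl fun i _ => ?_
    rw [ENNReal.coe_toNNReal (hfin _)]
    congr 1; ext x; simp

lemma sum_map_plan {T : S → E} (hT : Measurable T) (γ : Measure (S × S)) [IsFiniteMeasure γ]
    (c : E × E → ℝ≥0) :
    ((∑ z, (γ ((fun x => (T x.1, T x.2)) ⁻¹' {z})).toNNReal * c z : ℝ≥0) : ℝ≥0∞) =
      ∫⁻ x, c (T x.1, T x.2) ∂γ := by
  have hTT : Measurable (fun x : S × S => (T x.1, T x.2)) := by fun_prop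
  rw [← lintegral_map (μ := γ) (f := fun z => (c z : ℝ≥0∞)) (measurable_of_finite _) hTT,
    lintegral_fintype, ENNReal.ofNNReal_finsetSum]
  refine Finset.sum_congr rfl fun z _ => ?_
  rw [Measure.map_apply hTT (measurableSet_singleton z), ENNReal.coe_mul,
    ENNReal.coe_toNNReal (measure_ne_top γ _), mul_comm]

end Discretization

/-! ### Wasserstein distance versus its quantization -/

section Approximation

variable {S : Type*} [MetricSpace S] [SecondCountableTopology S] [MeasurableSpace S] [BorelSpace S]
  {E : Type*} [Fintype E] [MeasurableSpace E] [MeasurableSingletonClass E]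

lemma lintegral_rpow_add_add_le {X : Type*} [MeasurableSpace X] (γ : Measure X) {p : ℝ}
    (hp : 1 ≤ p) {f f₁ f₂ f₃ : X → ℝ≥0∞} (h₁ : Measurable f₁) (h₂ : Measurable f₂)
    (h₃ : Measurable f₃) (hf : ∀ x, f x ≤ f₁ x + f₂ x + f₃ x) :
    (∫⁻ x, f x ^ p ∂γ) ^ (1 / p) ≤ (∫⁻ x, f₁ x ^ p ∂γ) ^ (1 / p) + (∫⁻ x, f₂ x ^ p ∂γ) ^ (1 / p) +
      (∫⁻ x, f₃ x ^ p ∂γ) ^ (1 / p) := by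
  have hp0 : 0 ≤ p := by linarith
  calc (∫⁻ x, f x ^ p ∂γ) ^ (1 / p) ≤ (∫⁻ x, ((f₁ + f₂) + f₃) x ^ p ∂γ) ^ (1 / p) := by
        gcongr with x
        exact hf x
    _ ≤ (∫⁻ x, (f₁ + f₂) x ^ p ∂γ) ^ (1 / p) + (∫⁻ x, f₃ x ^ p ∂γ) ^ (1 / p) :=
        ENNReal.lintegral_Lp_add_le (h₁.add h₂).aemeasurable h₃.aemeasurable hp
    _ ≤ _ := by
        gcongr
        exact ENNReal.lintegral_Lp_add_le h₁.aemeasurable h₂.aemeasurable hp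

/-- The `L^p`-distance between the identity and a map with finitely many values. -/
noncomputable def quantizationError (p : ℝ) (T : S → E) (a : E → S) (μ : ProbabilityMeasure S) :
    ℝ≥0∞ :=
  (∫⁻ x, edist x (a (T x)) ^ p ∂(μ : Measure S)) ^ (1 / p)

/-- The Wasserstein distance between the images under a map with finitely many values. -/
noncomputable def quantizedDist (p : ℝ) (T : S → E) (a : E → S) (μ ν : ProbabilityMeasure S) :
    ℝ≥0∞ :=
  transportCost p (fun z => nndist (a z.1) (a z.2) ^ p) (cellMass T μ) (cellMass T ν)

lemma measurable_quantizedDist (p : ℝ) {T : S → E} (hT : Measurable T) (a : E → S) :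
    Measurable fun x : ProbabilityMeasure S × ProbabilityMeasure S =>
      quantizedDist p T a x.1 x.2 := by
  have h := measurable_transportCost p (fun z : E × E => nndist (a z.1) (a z.2) ^ p)
  have hc : Measurable fun x : ProbabilityMeasure S × ProbabilityMeasure S =>
      (cellMass T x.1, cellMass T x.2) :=
    ((measurable_cellMass hT).comp measurable_fst).prodMk
      ((measurable_cellMass hT).comp measurable_snd)
  exact Measurable.comp (g := fun x : (E → ℝ≥0) × (E → ℝ≥0) =>
    transportCost p (fun z : E × E => nndist (a z.1) (a z.2) ^ p) x.1 x.2)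
    (f := fun x : ProbabilityMeasure S × ProbabilityMeasure S => (cellMass T x.1, cellMass T x.2))
    h hc

lemma coe_nndist_rpow {p : ℝ} (hp : 1 ≤ p) (x y : S) :
    ((nndist x y ^ p : ℝ≥0) : ℝ≥0∞) = edist x y ^ p := by
  rw [edist_nndist, ENNReal.coe_rpow_of_nonneg _ (by linarith)]

lemma measurable_edist_comp {T : S → E} (hT : Measurable T) (a : E → S) :
    Measurable fun x => edist x (a (T x)) :=
  measurable_id.edist ((measurable_of_finite a).comp hT)

lemma lintegral_fst_of_mem_couplings {μ ν : ProbabilityMeasure S} {γ : Measure (S × S)}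
    (hγ : γ ∈ couplings (μ : Measure S) (ν : Measure S)) {f : S → ℝ≥0∞} (hf : Measurable f) :
    ∫⁻ z, f z.1 ∂γ = ∫⁻ x, f x ∂(μ : Measure S) := by
  rw [← hγ.2.1, lintegral_map hf measurable_fst]

lemma lintegral_snd_of_mem_couplings {μ ν : ProbabilityMeasure S} {γ : Measure (S × S)}
    (hγ : γ ∈ couplings (μ : Measure S) (ν : Measure S)) {f : S → ℝ≥0∞} (hf : Measurable f) :
    ∫⁻ z, f z.2 ∂γ = ∫⁻ x, f x ∂(ν : Measure S) := by
  rw [← hγ.2.2, lintegral_map hf measurable_snd]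

/-- Lift a plan between the cells to a coupling and apply Minkowski's inequality along the path `x,
a (T x), a (T y), y`. -/
lemma dist₁_le_quantizedDist_add {p : ℝ} (hp : 1 ≤ p) {T : S → E} (hT : Measurable T)
    (a : E → S) (μ ν : ProbabilityMeasure S) :
    dist₁ p μ ν ≤ quantizedDist p T a μ ν +
      (quantizationError p T a μ + quantizationError p T a ν) := by
  -- With the errors subtracted, the right side is a bare infimum and can be bounded plan by plan.
  rw [← tsub_le_iff_right]
  refine le_iInf₂ fun g hg => tsub_le_iff_right.2 ?_
  have hγ := liftPlan_mem_couplings hT hg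
  have hm := measurable_edist_comp hT a
  have haT : Measurable fun x => a (T x) := (measurable_of_finite a).comp hT
  have hp0 : 0 ≤ 1 / p := by positivity
  calc dist₁ p μ ν ≤ (∫⁻ z, edist z.1 z.2 ^ p ∂(liftPlan T μ ν g)) ^ (1 / p) := iInf₂_le _ hγ
    _ ≤ _ := lintegral_rpow_add_add_le _ hp
        (f₁ := fun z : S × S => edist (a (T z.1)) (a (T z.2)))
        (f₂ := fun z => edist z.1 (a (T z.1))) (f₃ := fun z => edist z.2 (a (T z.2)))
        ((haT.comp measurable_fst).edist (haT.comp measurable_snd))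
        (hm.comp measurable_fst) (hm.comp measurable_snd) (fun z => by
          calc edist z.1 z.2 ≤ edist z.1 (a (T z.1)) + edist (a (T z.1)) (a (T z.2)) +
                edist (a (T z.2)) z.2 := edist_triangle4 _ _ _ _
            _ = _ := by rw [edist_comm _ z.2, add_comm (edist z.1 _)])
    _ ≤ _ := by
      rw [add_assoc]
      gcongr
      · refine le_of_eq_of_le ?_ (lintegral_liftPlan_le hT μ ν g _)
        simp only [coe_nndist_rpow hp]
      · rw [lintegral_fst_of_mem_couplings hγ (hm.pow_const p)]; rfl
      · rw [lintegral_snd_of_mem_couplings hγ (hm.pow_const p)]; rfl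

/-- Push a coupling forward to the cells and apply Minkowski's inequality along the path `a (T x),
x, y, a (T y)`. -/
lemma quantizedDist_le_dist₁_add {p : ℝ} (hp : 1 ≤ p) {T : S → E} (hT : Measurable T)
    (a : E → S) (μ ν : ProbabilityMeasure S) :
    quantizedDist p T a μ ν ≤ dist₁ p μ ν +
      (quantizationError p T a μ + quantizationError p T a ν) := by
  rw [← tsub_le_iff_right]
  refine le_iInf₂ fun γ hγ => tsub_le_iff_right.2 ?_
  have hm := measurable_edist_comp hT a
  have := hγ.1
  calc quantizedDist p T a μ ν ≤
      (∫⁻ z, edist (a (T z.1)) (a (T z.2)) ^ p ∂γ) ^ (1 / p) := by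
        refine (iInf₂_le _ (map_mem_transportPlans hT hγ)).trans_eq ?_
        rw [sum_map_plan hT γ]
        simp only [coe_nndist_rpow hp]
    _ ≤ _ := lintegral_rpow_add_add_le _ hp (f₁ := fun z => edist z.1 z.2)
        (f₂ := fun z => edist z.1 (a (T z.1))) (f₃ := fun z => edist z.2 (a (T z.2)))
        measurable_edist (hm.comp measurable_fst) (hm.comp measurable_snd) (fun z => by
          calc edist (a (T z.1)) (a (T z.2)) ≤ edist (a (T z.1)) z.1 + edist z.1 z.2 +
                edist z.2 (a (T z.2)) := edist_triangle4 _ _ _ _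
            _ = _ := by rw [edist_comm _ z.1, add_comm (edist z.1 (a _))])
    _ = _ := by
      rw [lintegral_fst_of_mem_couplings hγ (hm.pow_const p),
        lintegral_snd_of_mem_couplings hγ (hm.pow_const p), add_assoc]
      rfl

end Approximation

/-! ### Joint measurability of the Wasserstein distance on `[S]_p` -/

section Measurability

variable {S : Type*} [MetricSpace S] [SecondCountableTopology S] [MeasurableSpace S] [BorelSpace S]

/-- The index of the cell of a point: the nearest of the first points of a dense sequence. -/
noncomputable def cellIndex (S : Type*) [MetricSpace S] [SecondCountableTopology S]
    [MeasurableSpace S] [BorelSpace S] [Nonempty S] (n : ℕ) (x : S) : Fin (n + 1) :=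
  ⟨SimpleFunc.nearestPtInd (TopologicalSpace.denseSeq S) n x,
    Nat.lt_succ_of_le (SimpleFunc.nearestPtInd_le _ _ _)⟩

/-- The point that represents a cell. -/
noncomputable def cellPoint (S : Type*) [MetricSpace S] [SecondCountableTopology S]
    [Nonempty S] (n : ℕ) (i : Fin (n + 1)) : S :=
  TopologicalSpace.denseSeq S i

lemma measurable_cellIndex [Nonempty S] (n : ℕ) : Measurable (cellIndex S n) := by
  refine measurable_to_countable' fun i => ?_
  have : cellIndex S n ⁻¹' {i} =
      SimpleFunc.nearestPtInd (TopologicalSpace.denseSeq S) n ⁻¹' {(i : ℕ)} := by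
    ext x
    simp [cellIndex, Fin.ext_iff]
  rw [this]
  exact SimpleFunc.measurableSet_fiber _ _

lemma cellPoint_cellIndex [Nonempty S] (n : ℕ) (x : S) :
    cellPoint S n (cellIndex S n x) =
      SimpleFunc.nearestPt (TopologicalSpace.denseSeq S) n x := rfl

lemma edist_rpow_le {p : ℝ} (hp : 1 ≤ p) (x y z : S) :
    edist x z ^ p ≤ 2 ^ (p - 1) * (edist x y ^ p + edist y z ^ p) :=
  (ENNReal.rpow_le_rpow (edist_triangle x y z) (by linarith)).trans
    (ENNReal.rpow_add_le_mul_rpow_add_rpow _ _ hp)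

lemma mem_finiteMoment_iff {p : ℝ} (hp : 1 ≤ p) (x₁ : S) (μ : ProbabilityMeasure S) :
    μ ∈ finiteMoment S p ↔ ∫⁻ x, edist x x₁ ^ p ∂(μ : Measure S) < ∞ := by
  refine ⟨fun ⟨x₀, h⟩ => ?_, fun h => ⟨x₁, h⟩⟩
  have hc : (2 : ℝ≥0∞) ^ (p - 1) ≠ ∞ := by simp
  calc ∫⁻ x, edist x x₁ ^ p ∂(μ : Measure S)
      ≤ ∫⁻ x, 2 ^ (p - 1) * (edist x x₀ ^ p + edist x₀ x₁ ^ p) ∂(μ : Measure S) :=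
        lintegral_mono fun x => edist_rpow_le hp _ _ _
    _ = 2 ^ (p - 1) * (∫⁻ x, edist x x₀ ^ p ∂(μ : Measure S) + edist x₀ x₁ ^ p) := by
        rw [lintegral_const_mul' _ _ hc, lintegral_add_right _ measurable_const]
        simp
    _ < ∞ := by
        refine ENNReal.mul_lt_top hc.lt_top (ENNReal.add_lt_top.2 ⟨h, ?_⟩)
        exact ENNReal.rpow_lt_top_of_nonneg (by linarith) (edist_ne_top _ _)

lemma measurableSet_finiteMoment [Nonempty S] {p : ℝ} (hp : 1 ≤ p) :
    MeasurableSet (finiteMoment S p) := by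
  obtain ⟨x₁⟩ := ‹Nonempty S›
  have : finiteMoment S p =
      {μ : ProbabilityMeasure S | ∫⁻ x, edist x x₁ ^ p ∂(μ : Measure S) < ∞} :=
    Set.ext fun μ => mem_finiteMoment_iff hp x₁ μ
  rw [this]
  refine measurableSet_lt ?_ measurable_const
  exact (Measure.measurable_lintegral (measurable_edist_left.pow_const p)).comp
    measurable_subtype_coe

/-- Dominated convergence: the nearest of the first points tends to `x` by density, and it is never
farther from `x` than the initial point of the sequence, whose distance to `x` has a finite `p`-th
moment. -/
lemma tendsto_quantizationError [Nonempty S] {p : ℝ} (hp : 1 ≤ p) {μ : ProbabilityMeasure S}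
    (hμ : μ ∈ finiteMoment S p) :
    Tendsto (fun n => quantizationError p (cellIndex S n) (cellPoint S n) μ) atTop (𝓝 0) := by
  have hp0 : 0 < p := by linarith
  have h0 : Tendsto (fun n => ∫⁻ x, edist x (cellPoint S n (cellIndex S n x)) ^ p
      ∂(μ : Measure S)) atTop (𝓝 (∫⁻ _, 0 ∂(μ : Measure S))) := by
    refine tendsto_lintegral_of_dominated_convergence
      (fun x => edist x (TopologicalSpace.denseSeq S 0) ^ p) (fun n => ?_) (fun n => ?_)
      ((mem_finiteMoment_iff hp _ μ).1 hμ).ne ?_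
    · exact (measurable_edist_comp (measurable_cellIndex n) _).pow_const p
    · refine Eventually.of_forall fun x => ?_
      dsimp only
      gcongr
      rw [cellPoint_cellIndex, edist_comm, edist_comm x]
      exact SimpleFunc.edist_nearestPt_le _ _ (Nat.zero_le n)
    · refine Eventually.of_forall fun x => ?_
      have h := SimpleFunc.tendsto_nearestPt (e := TopologicalSpace.denseSeq S) (x := x)
        (TopologicalSpace.denseRange_denseSeq S x)
      have h1 : Tendsto (fun n => edist x (cellPoint S n (cellIndex S n x))) atTop (𝓝 0) := by
        have := (tendsto_const_nhds (x := x)).edist h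
        simpa [cellPoint_cellIndex] using this
      simpa [hp0] using h1.ennrpow_const p
  simpa [quantizationError, hp0] using h0.ennrpow_const (1 / p)

/-- A jointly measurable function that equals the Wasserstein distance on `[S]_p`. -/
noncomputable def measurableDist [Nonempty S] (p : ℝ) (μ ν : ProbabilityMeasure S) : ℝ≥0∞ :=
  limsup (fun n => quantizedDist p (cellIndex S n) (cellPoint S n) μ ν) atTop

lemma measurable_measurableDist [Nonempty S] (p : ℝ) :
    Measurable fun x : ProbabilityMeasure S × ProbabilityMeasure S =>
      measurableDist p x.1 x.2 :=
  Measurable.limsup fun n => measurable_quantizedDist p (measurable_cellIndex n) _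

/-- The two quantization bounds differ from the distance by errors that vanish for finite `p`-th
moments. -/
lemma measurableDist_eq_dist₁ [Nonempty S] {p : ℝ} (hp : 1 ≤ p) {μ ν : ProbabilityMeasure S}
    (hμ : μ ∈ finiteMoment S p) (hν : ν ∈ finiteMoment S p) :
    measurableDist p μ ν = dist₁ p μ ν := by
  have hδ := (tendsto_quantizationError hp hμ).add (tendsto_quantizationError hp hν)
  rw [add_zero] at hδ
  refine le_antisymm ?_ ?_
  · calc measurableDist p μ ν ≤ limsup (fun n => dist₁ p μ ν +
          (quantizationError p (cellIndex S n) (cellPoint S n) μ +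
            quantizationError p (cellIndex S n) (cellPoint S n) ν)) atTop :=
          limsup_le_limsup (Eventually.of_forall fun n =>
            quantizedDist_le_dist₁_add hp (measurable_cellIndex n) _ μ ν)
      _ = dist₁ p μ ν := by
          have := hδ.const_add (dist₁ p μ ν)
          rw [add_zero] at this
          exact this.limsup_eq
  -- The subtracted sequence tends to `0`, so finiteness of `dist₁ p μ ν` is not needed.
  · have h := ENNReal.Tendsto.sub (tendsto_const_nhds (x := dist₁ p μ ν)) hδ
      (Or.inr ENNReal.zero_ne_top)
    rw [tsub_zero] at h
    rw [← h.limsup_eq]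
    exact limsup_le_limsup (Eventually.of_forall fun n => tsub_le_iff_right.2
      (dist₁_le_quantizedDist_add hp (measurable_cellIndex n) _ μ ν))

end Measurability

/-! ### The i.i.d. law as a measurable function of the marginal -/

section IidKernel

variable {S : Type*} [MeasurableSpace S]

instance isProbabilityMeasure_iidLaw (μ : ProbabilityMeasure S) :
    IsProbabilityMeasure (iidLaw μ) := by
  unfold iidLaw; infer_instance

lemma measurable_apply_probabilityMeasure {B : Set S} (hB : MeasurableSet B) :
    Measurable fun μ : ProbabilityMeasure S => (μ : Measure S) B :=
  (Measure.measurable_coe hB).comp measurable_subtype_coe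

lemma isPiSystem_measurable_squareCylinders :
    IsPiSystem (squareCylinders fun _ : ℕ => {s : Set S | MeasurableSet s}) :=
  isPiSystem_squareCylinders (fun _ => MeasurableSpace.isPiSystem_measurableSet)
    (fun _ => MeasurableSet.univ)

lemma iidLaw_pi (μ : ProbabilityMeasure S) (s : Finset ℕ) {t : ℕ → Set S}
    (ht : ∀ i ∈ s, MeasurableSet (t i)) :
    iidLaw μ (Set.pi s t) = ∏ i ∈ s, (μ : Measure S) (t i) :=
  Measure.infinitePi_pi _ ht

lemma measurable_iidLaw : Measurable (iidLaw : ProbabilityMeasure S → Measure (ℕ → S)) := by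
  refine Measurable.measure_of_isPiSystem_of_isProbabilityMeasure generateFrom_squareCylinders.symm
    isPiSystem_measurable_squareCylinders ?_
  rintro _ ⟨s, t, ht, rfl⟩
  simp only [iidLaw_pi _ s fun i _ => ht i trivial]
  exact Finset.measurable_prod _ fun i _ => measurable_apply_probabilityMeasure (ht i trivial)

end IidKernel

/-! ### Exchanges of coordinates and empirical measures -/

section Exchangeability

variable {S : Type*} [MeasurableSpace S] {ρ : Measure (ℕ → S)} [IsProbabilityMeasure ρ]

/-- A law on sequences is determined by its finite marginals, and every finite index set lies in
some initial segment, where exchangeability applies. -/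
lemma Exchangeable.map_comp_injective (hρ : Exchangeable ρ) {f : ℕ → ℕ}
    (hf : Function.Injective f) : ρ.map (fun ω i => ω (f i)) = ρ := by
  have hmf : Measurable fun (ω : ℕ → S) i => ω (f i) := by fun_prop
  refine IsProjectiveLimit.unique (P := fun I : Finset ℕ => ρ.map I.restrict) (fun I => ?_)
    (fun I => rfl)
  let n := I.sup id + 1
  have hI : ∀ i : I, (i : ℕ) < n := fun i => Nat.lt_succ_of_le (Finset.le_sup (f := id) i.2)
  let r : (Fin n → S) → (I → S) := fun x i => x ⟨i, hI i⟩
  have hr : Measurable r := by fun_prop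
  have hs : Measurable (sample n : (ℕ → S) → Fin n → S) := by unfold sample; fun_prop
  have h := hρ n (fun i => f i) (hf.comp Fin.val_injective)
  have h1 : (ρ.map (fun ω i => ω (f i))).map I.restrict =
      (ρ.map (fun ω (i : Fin n) => ω (f i))).map r := by
    rw [Measure.map_map (by fun_prop) hmf, Measure.map_map hr (by fun_prop)]
    rfl
  rw [h1, h, Measure.map_map hr hs]
  rfl

/-- The sequence with two coordinates exchanged. -/
def swapCoord (k j : ℕ) (ω : ℕ → S) : ℕ → S := fun i => ω (Equiv.swap k j i)

lemma Exchangeable.measurePreserving_swapCoord (hρ : Exchangeable ρ) (k j : ℕ) :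
    MeasurePreserving (swapCoord k j) ρ ρ :=
  ⟨by unfold swapCoord; fun_prop, hρ.map_comp_injective (Equiv.swap k j).injective⟩

lemma empiricalMeasure_swapCoord {k j n : ℕ} (hk : k ≤ n) (hj : j ≤ n) (ω : ℕ → S) :
    empiricalMeasure n (swapCoord k j ω) = empiricalMeasure n ω := by
  apply Subtype.ext
  simp only [empiricalMeasure]
  congr 1
  refine Finset.sum_equiv (Equiv.swap k j) (fun i => ?_) fun i _ => rfl
  simp only [Finset.mem_range]
  rcases eq_or_ne i k with rfl | hik
  · rw [Equiv.swap_apply_left]; omega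
  rcases eq_or_ne i j with rfl | hij
  · rw [Equiv.swap_apply_right]; omega
  · rw [Equiv.swap_apply_of_ne_of_ne hik hij]

lemma lintegral_empiricalMeasure (n : ℕ) (ω : ℕ → S) {f : S → ℝ≥0∞} (hf : Measurable f) :
    ∫⁻ x, f x ∂(empiricalMeasure n ω : Measure S) =
      ((n + 1 : ℕ) : ℝ≥0∞)⁻¹ * ∑ i ∈ Finset.range (n + 1), f (ω i) := by
  have : (empiricalMeasure n ω : Measure S) =
    ((n + 1 : ℕ) : ℝ≥0∞)⁻¹ • ∑ i ∈ Finset.range (n + 1), Measure.dirac (ω i) := rfl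
  rw [this, lintegral_smul_measure, lintegral_finsetSum_measure, smul_eq_mul]
  simp_rw [lintegral_dirac' _ hf]

end Exchangeability

/-! ### De Finetti's theorem -/

section DeFinetti

variable {S : Type*} [MetricSpace S] [SecondCountableTopology S] [MeasurableSpace S] [BorelSpace S]
  {ρ : Measure (ℕ → S)} [IsProbabilityMeasure ρ] {P : (ℕ → S) → ProbabilityMeasure S}

/-- Exchanging two coordinates leaves all late empirical measures unchanged, hence also their limit.
-/
lemma directing_swapCoord_ae_eq (hρ : Exchangeable ρ) (hP : IsDirectingMeasure ρ P) (k j : ℕ) :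
    ∀ᵐ ω ∂ρ, P (swapCoord k j ω) = P ω := by
  filter_upwards [hP.2, (hρ.measurePreserving_swapCoord k j).quasiMeasurePreserving.ae hP.2]
    with ω h h'
  refine tendsto_nhds_unique h' (h.congr' ?_)
  filter_upwards [eventually_ge_atTop k, eventually_ge_atTop j] with n hk hj
  exact (empiricalMeasure_swapCoord hk hj ω).symm

lemma tendsto_cesaro_of_eventually_eq {u : ℕ → ℝ≥0∞} {a : ℝ≥0∞} (k : ℕ) (hu : ∀ i, u i ≠ ∞)
    (h : ∀ j ≥ k, u j = a) :
    Tendsto (fun n : ℕ => ((n + 1 : ℕ) : ℝ≥0∞)⁻¹ * ∑ i ∈ Finset.range (n + 1), u i) atTop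
      (𝓝 a) := by
  have ha : a ≠ ∞ := h k le_rfl ▸ hu k
  have h1 : Tendsto (fun i => (u i).toReal) atTop (𝓝 a.toReal) :=
    tendsto_const_nhds.congr' (by
      filter_upwards [eventually_ge_atTop k] with j hj
      rw [h j hj])
  have h2 := (h1.cesaro).comp (tendsto_add_atTop_nat 1)
  have hne : ∀ n : ℕ, ((n + 1 : ℕ) : ℝ≥0∞)⁻¹ * ∑ i ∈ Finset.range (n + 1), u i ≠ ∞ := fun n =>
    ENNReal.mul_ne_top (by simp) (ENNReal.sum_ne_top.2 fun i _ => hu i)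
  rw [← ENNReal.tendsto_toReal_iff hne ha]
  refine h2.congr fun n => ?_
  simp only [Function.comp_apply, ENNReal.toReal_mul, ENNReal.toReal_inv, ENNReal.toReal_natCast]
  rw [ENNReal.toReal_sum fun i _ => hu i]

/-- By the invariance of `H`, all coordinates `j ≥ k` have the same law under the measure with
density `H`. This common law is thus the limit of the averaged laws, which are the means of the
empirical measures and converge to the mean of `P`. The coordinates before `k` do not affect the
limit. -/
lemma lintegral_mul_indicator_eq (hρ : Exchangeable ρ) (hP : IsDirectingMeasure ρ P)
    {H : (ℕ → S) → ℝ≥0∞} (hH : Measurable H) (hfin : ∫⁻ ω, H ω ∂ρ ≠ ∞) (k : ℕ)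
    (hinv : ∀ j ≥ k, ∀ᵐ ω ∂ρ, H (swapCoord k j ω) = H ω) {B : Set S} (hB : MeasurableSet B) :
    ∫⁻ ω, H ω * B.indicator 1 (ω k) ∂ρ = ∫⁻ ω, H ω * (P ω : Measure S) B ∂ρ := by
  have hPm : Measurable fun ω => (P ω : Measure S) := measurable_subtype_coe.comp hP.1
  set M := ρ.withDensity H with hM
  have : IsFiniteMeasure M := isFiniteMeasure_withDensity hfin
  have hshift : ∀ f : S → ℝ≥0∞, Measurable f → ∀ j ≥ k,
      ∫⁻ ω, f (ω j) ∂M = ∫⁻ ω, f (ω k) ∂M := by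
    intro f hf j hj
    have hfj : ∀ j, Measurable fun ω : ℕ → S => f (ω j) := fun j => hf.comp (measurable_pi_apply j)
    rw [hM, lintegral_withDensity_eq_lintegral_mul _ hH (hfj _),
      lintegral_withDensity_eq_lintegral_mul _ hH (hfj _),
      ← (hρ.measurePreserving_swapCoord k j).lintegral_comp (hH.mul (hfj j))]
    refine lintegral_congr_ae ?_
    filter_upwards [hinv j hj] with ω hω
    simp [hω, swapCoord]
  have hmeas : M.map (fun ω => ω k) = M.bind fun ω => (P ω : Measure S) := by
    -- Bounded continuous functions determine a finite measure, and they are what weak convergence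
    -- controls.
    refine ext_of_forall_lintegral_eq_of_IsFiniteMeasure fun f => ?_
    have hf : Measurable fun x => (f x : ℝ≥0∞) := f.continuous.measurable.coe_nnreal_ennreal
    have hfb : ∀ x, (f x : ℝ≥0∞) ≤ nndist f 0 := fun x =>
      ENNReal.coe_le_coe.2 (BoundedContinuousFunction.NNReal.upper_bound f x)
    rw [lintegral_map hf (measurable_pi_apply k),
      Measure.lintegral_bind hPm.aemeasurable hf.aemeasurable]
    have hbound : ∀ j, ∫⁻ ω, (f (ω j) : ℝ≥0∞) ∂M ≠ ∞ := fun j => by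
      refine ne_top_of_le_ne_top ?_ (lintegral_mono fun ω => hfb (ω j))
      rw [lintegral_const]
      exact ENNReal.mul_ne_top ENNReal.coe_ne_top (measure_ne_top _ _)
    have h1 := tendsto_cesaro_of_eventually_eq k hbound (hshift _ hf)
    have h2 : Tendsto (fun n => ∫⁻ ω, ∫⁻ x, f x ∂(empiricalMeasure n ω : Measure S) ∂M) atTop
        (𝓝 (∫⁻ ω, ∫⁻ x, f x ∂(P ω : Measure S) ∂M)) := by
      refine tendsto_lintegral_of_dominated_convergence (fun _ => (nndist f 0 : ℝ≥0∞))
        (fun n => ?_) (fun n => ?_) ?_ ?_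
      · simp only [lintegral_empiricalMeasure n _ hf]
        exact (Finset.measurable_sum _ fun i _ => hf.comp (measurable_pi_apply i)).const_mul _
      · refine Eventually.of_forall fun ω => ?_
        refine (lintegral_mono hfb).trans_eq ?_
        rw [lintegral_const, measure_univ, mul_one]
      · rw [lintegral_const]
        exact ENNReal.mul_ne_top ENNReal.coe_ne_top (measure_ne_top _ _)
      · have hac : M ≪ ρ := withDensity_absolutelyContinuous _ _
        filter_upwards [hac.ae_le hP.2] with ω hω
        exact ProbabilityMeasure.tendsto_iff_forall_lintegral_tendsto.1 hω f
    refine tendsto_nhds_unique h1 (h2.congr fun n => ?_)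
    simp only [lintegral_empiricalMeasure n _ hf]
    have hfi : ∀ i, Measurable fun ω : ℕ → S => (f (ω i) : ℝ≥0∞) := fun i =>
      hf.comp (measurable_pi_apply i)
    rw [lintegral_const_mul _ (Finset.measurable_sum _ fun i _ => hfi i),
      lintegral_finsetSum _ fun i _ => hfi i]
  have h := congrArg (fun m : Measure S => m B) hmeas
  rw [Measure.map_apply (measurable_pi_apply k) hB, Measure.bind_apply hB hPm.aemeasurable, hM,
    lintegral_withDensity_eq_lintegral_mul _ hH
      (show Measurable fun ω => (P ω : Measure S) B from (Measure.measurable_coe hB).comp hPm),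
    ← lintegral_indicator_one (hB.preimage (measurable_pi_apply k)),
    lintegral_withDensity_eq_lintegral_mul _ hH
      (measurable_one.indicator (hB.preimage (measurable_pi_apply k)))] at h
  exact h

/-- Induction on `k`: the last indicator is replaced by `P ω (B k)`, since the other factors are
invariant under exchanges of later coordinates. This number is a function of `P ω` and is absorbed
into `φ`, which therefore has to be arbitrary. -/
lemma lintegral_mul_prod_indicator_eq (hρ : Exchangeable ρ) (hP : IsDirectingMeasure ρ P)
    {B : ℕ → Set S} (hB : ∀ i, MeasurableSet (B i)) (k : ℕ) {φ : ProbabilityMeasure S → ℝ≥0∞}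
    (hφ : Measurable φ) (hφ1 : ∀ μ, φ μ ≤ 1) :
    ∫⁻ ω, φ (P ω) * ∏ i ∈ Finset.range k, (B i).indicator 1 (ω i) ∂ρ =
      ∫⁻ ω, φ (P ω) * ∏ i ∈ Finset.range k, (P ω : Measure S) (B i) ∂ρ := by
  induction k generalizing φ with
  | zero => simp
  | succ k ih =>
    have hind : ∀ i, Measurable fun ω : ℕ → S => (B i).indicator (1 : S → ℝ≥0∞) (ω i) := fun i =>
      (measurable_one.indicator (hB i)).comp (measurable_pi_apply i)
    have hH : Measurable fun ω => φ (P ω) *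
        ∏ i ∈ Finset.range k, (B i).indicator (1 : S → ℝ≥0∞) (ω i) :=
      (hφ.comp hP.1).mul (Finset.measurable_prod _ fun i _ => hind i)
    have hle : ∀ ω, φ (P ω) * ∏ i ∈ Finset.range k, (B i).indicator (1 : S → ℝ≥0∞) (ω i) ≤ 1 :=
      fun ω => mul_le_one' (hφ1 _) (Finset.prod_le_one' fun i _ =>
        Set.indicator_le_self' (fun _ _ => zero_le) _)
    have hfin : ∫⁻ ω, φ (P ω) * ∏ i ∈ Finset.range k, (B i).indicator (1 : S → ℝ≥0∞) (ω i) ∂ρ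
        ≠ ∞ := by
      refine ne_top_of_le_ne_top ?_ (lintegral_mono hle)
      simp
    have hstep := lintegral_mul_indicator_eq hρ hP hH hfin k (fun j hj => by
      filter_upwards [directing_swapCoord_ae_eq hρ hP k j] with ω hω
      rw [hω]
      congr 1
      refine Finset.prod_congr rfl fun i hi => ?_
      have hik : i < k := Finset.mem_range.1 hi
      rw [swapCoord, Equiv.swap_apply_of_ne_of_ne (by omega) (by omega)]) (hB k)
    have hih := ih (φ := fun μ => φ μ * (μ : Measure S) (B k))
      (hφ.mul (measurable_apply_probabilityMeasure (hB k)))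
      (fun μ => mul_le_one' (hφ1 μ) prob_le_one)
    simp only [Finset.prod_range_succ]
    calc _ = ∫⁻ ω, φ (P ω) * (∏ i ∈ Finset.range k, (B i).indicator (1 : S → ℝ≥0∞) (ω i)) *
          (B k).indicator 1 (ω k) ∂ρ := by simp only [mul_assoc]
      _ = _ := hstep
      _ = _ := by
        refine Eq.trans (lintegral_congr fun ω => ?_) (hih.trans (lintegral_congr fun ω => ?_))
        · ring
        · ring

lemma measure_inter_pi_eq (hρ : Exchangeable ρ) (hP : IsDirectingMeasure ρ P)
    {D : Set (ProbabilityMeasure S)} (hD : MeasurableSet D) (s : Finset ℕ) {t : ℕ → Set S}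
    (ht : ∀ i, MeasurableSet (t i)) :
    ρ (P ⁻¹' D ∩ Set.pi s t) = ∫⁻ ω in P ⁻¹' D, iidLaw (P ω) (Set.pi s t) ∂ρ := by
  classical
  obtain ⟨k, hk⟩ : ∃ k, ∀ i ∈ s, i < k :=
    ⟨s.sup id + 1, fun i hi => Nat.lt_succ_of_le (Finset.le_sup (f := id) hi)⟩
  let B : ℕ → Set S := fun i => if i ∈ s then t i else Set.univ
  have hB : ∀ i, MeasurableSet (B i) := fun i => by
    by_cases hi : i ∈ s <;> simp [B, hi, ht]
  have hset : (Set.pi s t : Set (ℕ → S)) = Set.pi (Finset.range k) B := by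
    ext ω
    simp only [Set.mem_pi, Finset.mem_coe, Finset.mem_range, B]
    constructor
    · intro h i _
      by_cases hi : i ∈ s
      · simpa [hi] using h i hi
      · simp [hi]
    · intro h i hi
      simpa [hi] using h i (hk i hi)
  have hpim : MeasurableSet (Set.pi (Finset.range k) B : Set (ℕ → S)) :=
    MeasurableSet.pi (Finset.countable_toSet _) fun i _ => hB i
  have hDm : MeasurableSet (P ⁻¹' D) := hP.1 hD
  rw [hset, ← lintegral_indicator hDm, ← lintegral_indicator_one (hDm.inter hpim)]
  have h := lintegral_mul_prod_indicator_eq hρ hP hB k (φ := D.indicator 1)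
    (measurable_one.indicator hD) (fun μ => Set.indicator_le_self' (fun _ _ => zero_le) _)
  refine Eq.trans (lintegral_congr fun ω => ?_) (h.trans (lintegral_congr fun ω => ?_))
  · by_cases hω : P ω ∈ D
    · by_cases hω2 : ∀ i ∈ Finset.range k, ω i ∈ B i
      · rw [Set.indicator_of_mem (show ω ∈ P ⁻¹' D ∩ Set.pi (Finset.range k) B from ⟨hω, hω2⟩),
          Set.indicator_of_mem hω, Finset.prod_eq_one fun i hi => Set.indicator_of_mem (hω2 i hi) _]
        simp
      · rw [Set.indicator_of_notMem fun h => hω2 h.2]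
        push Not at hω2
        obtain ⟨i, hi, hiB⟩ := hω2
        rw [Finset.prod_eq_zero hi (Set.indicator_of_notMem hiB _), mul_zero]
    · rw [Set.indicator_of_notMem fun h => hω h.1, Set.indicator_of_notMem hω, zero_mul]
  · have hpi := iidLaw_pi (P ω) (Finset.range k) fun i _ => hB i
    by_cases hω : P ω ∈ D
    · rw [Set.indicator_of_mem hω, Set.indicator_of_mem (Set.mem_preimage.2 hω), hpi,
        Pi.one_apply, one_mul]
    · rw [Set.indicator_of_notMem hω, zero_mul,
        Set.indicator_of_notMem (s := P ⁻¹' D) hω]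

/-- The kernel that maps a probability measure to the law of an i.i.d. sequence. -/
noncomputable def iidKernel (S : Type*) [MeasurableSpace S] :
    Kernel (ProbabilityMeasure S) (ℕ → S) :=
  ⟨iidLaw, measurable_iidLaw⟩

instance isMarkovKernel_iidKernel : IsMarkovKernel (iidKernel S) :=
  ⟨fun μ => isProbabilityMeasure_iidLaw μ⟩

/-- De Finetti's theorem: given the directing random measure, the coordinates are i.i.d. -/
theorem map_directing_prodMk_eq (hρ : Exchangeable ρ) (hP : IsDirectingMeasure ρ P) :
    ρ.map (fun ω => (P ω, ω)) = (ρ.map P) ⊗ₘ iidKernel S := by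
  have hPid : Measurable fun ω => (P ω, ω) := hP.1.prodMk measurable_id
  have : IsProbabilityMeasure (ρ.map P) := Measure.isProbabilityMeasure_map hP.1.aemeasurable
  have : IsProbabilityMeasure (ρ.map fun ω => (P ω, ω)) :=
    Measure.isProbabilityMeasure_map hPid.aemeasurable
  have hκ : Measurable fun ω => iidLaw (P ω) := measurable_iidLaw.comp hP.1
  refine Measure.ext_prod fun {D F} hD hF => ?_
  have hDm : MeasurableSet (P ⁻¹' D) := hP.1 hD
  have hrect : (fun ω => (P ω, ω)) ⁻¹' (D ×ˢ F) = F ∩ P ⁻¹' D := by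
    ext ω; simp [and_comm]
  rw [Measure.map_apply hPid (hD.prod hF), Measure.compProd_apply_prod hD hF,
    setLIntegral_map hD ((iidKernel S).measurable_coe hF) hP.1, hrect, ← Measure.restrict_apply hF]
  -- For fixed `D` both sides are finite measures in the second variable, so agreement on cylinders
  -- suffices.
  have hbind : ρ.restrict (P ⁻¹' D) = (ρ.restrict (P ⁻¹' D)).bind fun ω => iidLaw (P ω) := by
    refine ext_of_generate_finite _ generateFrom_squareCylinders.symm
      isPiSystem_measurable_squareCylinders ?_ ?_
    · rintro _ ⟨s, t, ht, rfl⟩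
      have hm : MeasurableSet (Set.pi s t : Set (ℕ → S)) :=
        MeasurableSet.pi s.countable_toSet fun i _ => ht i trivial
      rw [Measure.restrict_apply hm, Measure.bind_apply hm hκ.aemeasurable, Set.inter_comm]
      exact measure_inter_pi_eq hρ hP hD s fun i => ht i trivial
    · rw [Measure.bind_apply .univ hκ.aemeasurable]
      simp
  conv_lhs => rw [hbind]
  rw [Measure.bind_apply hF hκ.aemeasurable]
  rfl

lemma lintegral_directing_eq (hρ : Exchangeable ρ) (hP : IsDirectingMeasure ρ P)
    {F : ProbabilityMeasure S × (ℕ → S) → ℝ≥0∞} (hF : Measurable F) :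
    ∫⁻ ω, F (P ω, ω) ∂ρ = ∫⁻ ω, ∫⁻ ω', F (P ω, ω') ∂(iidLaw (P ω)) ∂ρ := by
  have hPid : Measurable fun ω => (P ω, ω) := hP.1.prodMk measurable_id
  have : IsProbabilityMeasure (ρ.map P) := Measure.isProbabilityMeasure_map hP.1.aemeasurable
  rw [← lintegral_map hF hPid, map_directing_prodMk_eq hρ hP, Measure.lintegral_compProd hF,
    lintegral_map hF.lintegral_kernel_prod_right' hP.1]
  rfl

end DeFinetti

/-! ### Posterior expectations and Hunt's lemma -/

section Posterior

variable {S : Type*} [MeasurableSpace S] {ρ : Measure (ℕ → S)} [IsProbabilityMeasure ρ]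
  {P : (ℕ → S) → ProbabilityMeasure S}

lemma measurable_sample (n : ℕ) : Measurable (sample n : (ℕ → S) → Fin n → S) := by
  unfold sample; fun_prop

lemma sampleSigma_le (n : ℕ) : sampleSigma S n ≤ MeasurableSpace.pi :=
  (measurable_sample n).comap_le

/-- The filtration generated by the coordinates. -/
def sampleFiltration (S : Type*) [MeasurableSpace S] :
    Filtration ℕ (MeasurableSpace.pi : MeasurableSpace (ℕ → S)) where
  seq := sampleSigma S
  mono' := by
    intro m n hmn
    let r : (Fin n → S) → (Fin m → S) := fun x i => x (Fin.castLE hmn i)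
    have hr : Measurable r := by fun_prop
    have h : (sample m : (ℕ → S) → Fin m → S) = r ∘ sample n := rfl
    change MeasurableSpace.comap (sample m) _ ≤ MeasurableSpace.comap (sample n) _
    rw [h, ← MeasurableSpace.comap_comp]
    exact MeasurableSpace.comap_mono hr.comap_le
  le' := sampleSigma_le

lemma iSup_sampleFiltration :
    ⨆ n, sampleFiltration S n = (MeasurableSpace.pi : MeasurableSpace (ℕ → S)) := by
  refine le_antisymm (iSup_le sampleSigma_le) (iSup_le fun i => ?_)
  refine le_trans ?_ (le_iSup _ (i + 1))
  have h : (fun ω : ℕ → S => ω i) = (fun x => x (Fin.last i)) ∘ sample (i + 1) := rfl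
  change MeasurableSpace.comap (fun ω : ℕ → S => ω i) _ ≤ MeasurableSpace.comap (sample (i + 1)) _
  rw [h, ← MeasurableSpace.comap_comp]
  exact MeasurableSpace.comap_mono (measurable_pi_apply _).comap_le

/-- Turns the setwise conditional probabilities into a disintegration of the joint law, so that
functions of both sample and measure can be integrated. -/
lemma IsPosterior.map_prodMk_eq (hP : Measurable P) {n : ℕ}
    {κ : Kernel (Fin n → S) (ProbabilityMeasure S)} (hκ : IsPosterior ρ P n κ) :
    ρ.map (fun ω => (sample n ω, P ω)) = (ρ.map (sample n)) ⊗ₘ κ := by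
  have := hκ.1
  have hs := measurable_sample (S := S) n
  have hsP : Measurable fun ω => (sample n ω, P ω) := hs.prodMk hP
  have : IsProbabilityMeasure (ρ.map (sample n)) :=
    Measure.isProbabilityMeasure_map hs.aemeasurable
  have : IsProbabilityMeasure (ρ.map fun ω => (sample n ω, P ω)) :=
    Measure.isProbabilityMeasure_map hsP.aemeasurable
  refine Measure.ext_prod fun {A B} hA hB => ?_
  have hA' : MeasurableSet[sampleSigma S n] (sample n ⁻¹' A) := ⟨A, hA, rfl⟩
  rw [Measure.map_apply hsP (hA.prod hB), Measure.compProd_apply_prod hA hB,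
    setLIntegral_map hA (κ.measurable_coe hB) hs]
  have hint : Integrable ((P ⁻¹' B).indicator fun _ => (1 : ℝ)) ρ :=
    (integrable_const 1).indicator (hP hB)
  have h1 : ∫ ω in sample n ⁻¹' A, (κ (sample n ω)).real B ∂ρ =
      ρ.real (sample n ⁻¹' A ∩ P ⁻¹' B) := by
    rw [setIntegral_congr_ae₀ (hs hA).nullMeasurableSet
      ((hκ.2 B hB).mono fun ω h _ => h), setIntegral_condExp (sampleSigma_le n) hint hA',
      integral_indicator (hP hB)]
    simp [Measure.real, Measure.restrict_restrict (hP hB), Set.inter_comm]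
  have h2 : ∀ ω, ENNReal.ofReal ((κ (sample n ω)).real B) = κ (sample n ω) B := fun ω =>
    ofReal_measureReal
  have hm : Measurable fun ω => (κ (sample n ω)).real B :=
    ((κ.measurable_coe hB).comp hs).ennreal_toReal
  have hi : Integrable (fun ω => (κ (sample n ω)).real B) ρ :=
    Integrable.of_bound hm.aestronglyMeasurable 1 (Eventually.of_forall fun ω => by
      rw [Real.norm_of_nonneg measureReal_nonneg]; exact measureReal_le_one)
  simp_rw [← h2]
  rw [← ofReal_integral_eq_lintegral_ofReal hi.integrableOn
    (Eventually.of_forall fun ω => measureReal_nonneg), h1, ofReal_measureReal]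
  rfl

lemma IsPosterior.setLIntegral_eq (hP : Measurable P) {n : ℕ}
    {κ : Kernel (Fin n → S) (ProbabilityMeasure S)} (hκ : IsPosterior ρ P n κ)
    {F : (Fin n → S) × ProbabilityMeasure S → ℝ≥0∞} (hF : Measurable F)
    {A : Set (ℕ → S)} (hA : MeasurableSet[sampleSigma S n] A) :
    ∫⁻ ω in A, ∫⁻ μ, F (sample n ω, μ) ∂(κ (sample n ω)) ∂ρ =
      ∫⁻ ω in A, F (sample n ω, P ω) ∂ρ := by
  have := hκ.1
  have hs := measurable_sample (S := S) n
  have hsP : Measurable fun ω => (sample n ω, P ω) := hs.prodMk hP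
  obtain ⟨A, hA, rfl⟩ := hA
  have : IsProbabilityMeasure (ρ.map (sample n)) :=
    Measure.isProbabilityMeasure_map hs.aemeasurable
  have h := setLIntegral_map (μ := ρ) (hA.prod .univ) hF hsP
  rw [hκ.map_prodMk_eq hP, Measure.setLIntegral_compProd hF hA .univ,
    setLIntegral_map hA (by simpa using hF.lintegral_kernel_prod_right') hs] at h
  simpa [Set.mk_preimage_prod] using h

lemma IsPosterior.ae_mem (hP : Measurable P) {n : ℕ}
    {κ : Kernel (Fin n → S) (ProbabilityMeasure S)} (hκ : IsPosterior ρ P n κ)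
    {B : Set (ProbabilityMeasure S)} (hB : MeasurableSet B) (h : ∀ᵐ ω ∂ρ, P ω ∈ B) :
    ∀ᵐ ω ∂ρ, ∀ᵐ μ ∂(κ (sample n ω)), μ ∈ B := by
  have := hκ.1
  have hF : Measurable fun z : (Fin n → S) × ProbabilityMeasure S =>
      Bᶜ.indicator (1 : ProbabilityMeasure S → ℝ≥0∞) z.2 := (measurable_one.indicator hB.compl).comp measurable_snd
  have h1 := hκ.setLIntegral_eq hP hF MeasurableSet.univ
  simp only [lintegral_indicator_one hB.compl, setLIntegral_univ] at h1
  have h2 : ∫⁻ ω, Bᶜ.indicator (1 : ProbabilityMeasure S → ℝ≥0∞) (P ω) ∂ρ = 0 := by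
    refine lintegral_eq_zero_of_ae_eq_zero ?_
    filter_upwards [h] with ω hω
    exact Set.indicator_of_notMem (Set.notMem_compl_iff.2 hω) _
  have hm : Measurable fun ω => κ (sample n ω) Bᶜ :=
    (κ.measurable_coe hB.compl).comp (measurable_sample n)
  rw [h2, lintegral_eq_zero_iff hm] at h1
  filter_upwards [h1] with ω hω
  exact hω

/-- Both sides are measurable with respect to the sample, so it suffices to compare their integrals
over events of `sampleSigma S n`, where conditioning may be undone. -/
lemma IsPosterior.lintegral_le_condExp (hP : Measurable P) {n : ℕ}
    {κ : Kernel (Fin n → S) (ProbabilityMeasure S)} (hκ : IsPosterior ρ P n κ)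
    {F : (Fin n → S) × ProbabilityMeasure S → ℝ≥0∞} (hF : Measurable F) {V : (ℕ → S) → ℝ≥0∞}
    (hV : Measurable V) (hVint : ∫⁻ ω, V ω ∂ρ ≠ ∞) (hFV : ∀ ω, F (sample n ω, P ω) ≤ V ω) :
    ∀ᵐ ω ∂ρ, ∫⁻ μ, F (sample n ω, μ) ∂(κ (sample n ω)) ≤
      ENNReal.ofReal ((ρ[fun ω => (V ω).toReal | sampleSigma S n]) ω) := by
  have := hκ.1
  have hle := sampleSigma_le (S := S) n
  have hVi : Integrable (fun ω => (V ω).toReal) ρ := integrable_toReal_of_lintegral_ne_top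
    hV.aemeasurable hVint
  have hZ : Measurable[sampleSigma S n] fun ω => ∫⁻ μ, F (sample n ω, μ) ∂(κ (sample n ω)) :=
    (hF.lintegral_kernel_prod_right' (κ := κ)).comp (comap_measurable _)
  have hE : Measurable[sampleSigma S n] fun ω =>
      ENNReal.ofReal ((ρ[fun ω => (V ω).toReal | sampleSigma S n]) ω) :=
    stronglyMeasurable_condExp.measurable.ennreal_ofReal
  have hE0 : 0 ≤ᵐ[ρ] ρ[fun ω => (V ω).toReal | sampleSigma S n] :=
    condExp_nonneg (Eventually.of_forall fun ω => ENNReal.toReal_nonneg)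
  refine ae_of_ae_trim hle ?_
  refine @ae_le_of_forall_setLIntegral_le_of_sigmaFinite _ (sampleSigma S n) _ _ _ _ hZ
    fun A hA _ => ?_
  rw [restrict_trim hle _ hA, lintegral_trim hle hZ, lintegral_trim hle hE,
    hκ.setLIntegral_eq hP hF hA,
    ← ofReal_integral_eq_lintegral_ofReal integrable_condExp.integrableOn
      (ae_restrict_of_ae hE0), setIntegral_condExp hle hVi hA,
    ofReal_integral_eq_lintegral_ofReal hVi.integrableOn
      (Eventually.of_forall fun ω => ENNReal.toReal_nonneg)]
  refine lintegral_mono_ae ?_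
  filter_upwards [ae_restrict_of_ae (ae_lt_top hV hVint)] with ω hω
  rw [ENNReal.ofReal_toReal hω.ne]
  exact hFV ω

lemma ae_tendsto_condExp_sampleSigma {V : (ℕ → S) → ℝ≥0∞} (hV : Measurable V)
    (hVint : ∫⁻ ω, V ω ∂ρ ≠ ∞) :
    ∀ᵐ ω ∂ρ, Tendsto (fun n => ENNReal.ofReal
      ((ρ[fun ω => (V ω).toReal | sampleSigma S n]) ω)) atTop (𝓝 (V ω)) := by
  have hVi : Integrable (fun ω => (V ω).toReal) ρ := integrable_toReal_of_lintegral_ne_top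
    hV.aemeasurable hVint
  have h := hVi.tendsto_ae_condExp (ℱ := sampleFiltration S) (by
    rw [iSup_sampleFiltration]
    exact hV.ennreal_toReal.stronglyMeasurable)
  filter_upwards [h, ae_lt_top hV hVint] with ω hω hlt
  have := ENNReal.tendsto_ofReal hω
  rwa [ENNReal.ofReal_toReal hlt.ne] at this

/-- Hunt's lemma for posterior expectations of a dominated sequence. -/
theorem limsup_posterior_lintegral_le (hP : Measurable P)
    {post : (n : ℕ) → Kernel (Fin n → S) (ProbabilityMeasure S)}
    (hpost : ∀ n ≥ 1, IsPosterior ρ P n (post n))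
    {F : (n : ℕ) → (Fin n → S) × ProbabilityMeasure S → ℝ≥0∞} (hF : ∀ n, Measurable (F n))
    (hint : ∫⁻ ω, ⨆ n, F n (sample n ω, P ω) ∂ρ ≠ ∞) :
    ∀ᵐ ω ∂ρ, limsup (fun n => ∫⁻ μ, F n (sample n ω, μ) ∂(post n (sample n ω))) atTop ≤
      limsup (fun n => F n (sample n ω, P ω)) atTop := by
  have hX : ∀ n, Measurable fun ω => F n (sample n ω, P ω) := fun n =>
    (hF n).comp ((measurable_sample n).prodMk hP)
  -- The tail suprema do not depend on the conditioning index `n`, so Lévy's theorem applies to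
  -- each; their infimum over `m` is the limsup.
  let V : ℕ → (ℕ → S) → ℝ≥0∞ := fun m ω => ⨆ n ≥ m, F n (sample n ω, P ω)
  have hV : ∀ m, Measurable (V m) := fun m =>
    Measurable.iSup fun n => Measurable.iSup fun _ => hX n
  have hVint : ∀ m, ∫⁻ ω, V m ω ∂ρ ≠ ∞ := fun m =>
    ne_top_of_le_ne_top hint (lintegral_mono fun ω => iSup₂_le fun n _ =>
      le_iSup (fun n => F n (sample n ω, P ω)) n)
  have h1 : ∀ᵐ ω ∂ρ, ∀ m n, 1 ≤ n → m ≤ n → ∫⁻ μ, F n (sample n ω, μ) ∂(post n (sample n ω)) ≤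
      ENNReal.ofReal ((ρ[fun ω => (V m ω).toReal | sampleSigma S n]) ω) := by
    simp only [ae_all_iff]
    intro m n hn hmn
    exact (hpost n hn).lintegral_le_condExp hP (hF n) (hV m) (hVint m) fun ω =>
      le_iSup₂ (f := fun n (_ : n ≥ m) => F n (sample n ω, P ω)) n hmn
  have h2 := ae_all_iff.2 fun m => ae_tendsto_condExp_sampleSigma (hV m) (hVint m)
  filter_upwards [h1, h2] with ω hω1 hω2
  rw [limsup_eq_iInf_iSup_of_nat (u := fun n => F n (sample n ω, P ω))]
  refine le_iInf fun m => ?_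
  change _ ≤ V m ω
  rw [← (hω2 m).limsup_eq]
  refine limsup_le_limsup ?_
  filter_upwards [eventually_ge_atTop 1, eventually_ge_atTop m] with n hn hmn
  exact hω1 m n hn hmn

/-- The sequence that starts with a given sample and is constant afterwards. -/
def padSample (x₀ : S) (n : ℕ) (s : Fin n → S) : ℕ → S :=
  fun i => if h : i < n then s ⟨i, h⟩ else x₀

lemma measurable_padSample (x₀ : S) (n : ℕ) : Measurable (padSample x₀ n) := by
  refine measurable_pi_lambda _ fun i => ?_
  by_cases h : i < n
  · simpa [padSample, h] using measurable_pi_apply _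
  · simp [padSample, h]

lemma sample_padSample (x₀ : S) (n : ℕ) (s : Fin n → S) : sample n (padSample x₀ n s) = s := by
  ext i
  simp [sample, padSample]

/-- Evaluations on measurable sets separate probability measures, and each level set of an
evaluation of `f` is a preimage under `sample n`. -/
lemma eq_of_sample_eq {n : ℕ} {f : (ℕ → S) → ProbabilityMeasure S}
    (hf : Measurable[sampleSigma S n] f) {ω ω' : ℕ → S} (h : sample n ω = sample n ω') :
    f ω = f ω' := by
  apply Subtype.ext
  ext B hB
  obtain ⟨A, -, hA⟩ := hf (measurable_apply_probabilityMeasure hB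
    (measurableSet_singleton ((f ω : Measure S) B)))
  have h1 : ω ∈ sample n ⁻¹' A := by rw [hA]; rfl
  have h2 : ω' ∈ sample n ⁻¹' A := by rwa [Set.mem_preimage, ← h]
  rw [hA] at h2
  exact (show (f ω' : Measure S) B = (f ω : Measure S) B from h2).symm

end Posterior

/-! ### From i.i.d. laws to `ρ`, and the bound for a Dirac target -/

section Transfer

variable {S : Type*} [MetricSpace S] [SecondCountableTopology S] [MeasurableSpace S] [BorelSpace S]
  {ρ : Measure (ℕ → S)} [IsProbabilityMeasure ρ] {P : (ℕ → S) → ProbabilityMeasure S}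

/-- An almost sure bound under the i.i.d. laws carries over to the exchangeable law; the bound
itself need not be measurable. -/
lemma ae_le_of_ae_iidLaw_le (hρ : Exchangeable ρ) (hP : IsDirectingMeasure ρ P)
    {L : ProbabilityMeasure S × (ℕ → S) → ℝ≥0∞} (hL : Measurable L)
    {Y : ProbabilityMeasure S → ℝ≥0∞}
    (h : ∀ᵐ ω ∂ρ, ∀ᵐ ω' ∂(iidLaw (P ω)), L (P ω, ω') ≤ Y (P ω)) :
    ∀ᵐ ω ∂ρ, L (P ω, ω) ≤ Y (P ω) := by
  -- At a fixed level `q` the exceptional set is measurable and de Finetti's theorem shows it to be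
  -- null. Rational levels between `Y` and `L` then replace the possibly nonmeasurable `Y`.
  have hq : ∀ q : ℝ≥0, ∀ᵐ ω ∂ρ, iidLaw (P ω) {ω' | (q : ℝ≥0∞) < L (P ω, ω')} = 0 →
      L (P ω, ω) ≤ q := by
    intro q
    have hU : MeasurableSet {z | (q : ℝ≥0∞) < L z} := measurableSet_lt measurable_const hL
    have hN : MeasurableSet {μ | iidLaw μ {ω' | (q : ℝ≥0∞) < L (μ, ω')} = 0} :=
      (Kernel.measurable_kernel_prodMk_left (κ := iidKernel S) hU) (measurableSet_singleton 0)
    let G : Set (ProbabilityMeasure S × (ℕ → S)) :=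
      (Prod.fst ⁻¹' {μ | iidLaw μ {ω' | (q : ℝ≥0∞) < L (μ, ω')} = 0}) ∩ {z | (q : ℝ≥0∞) < L z}
    have hG : MeasurableSet G := (measurable_fst hN).inter hU
    have hGm : Measurable (G.indicator (1 : ProbabilityMeasure S × (ℕ → S) → ℝ≥0∞)) := measurable_one.indicator hG
    have h0 : ∫⁻ ω, G.indicator 1 (P ω, ω) ∂ρ = 0 := by
      rw [lintegral_directing_eq hρ hP hGm]
      refine (lintegral_congr fun ω => ?_).trans lintegral_zero
      by_cases hω : iidLaw (P ω) {ω' | (q : ℝ≥0∞) < L (P ω, ω')} = 0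
      · refine lintegral_eq_zero_of_ae_eq_zero ?_
        rw [measure_eq_zero_iff_ae_notMem] at hω
        filter_upwards [hω] with ω' hω'
        exact Set.indicator_of_notMem (fun h => hω' h.2) _
      · refine (lintegral_congr fun ω' => ?_).trans lintegral_zero
        exact Set.indicator_of_notMem (fun h => hω h.1) _
    have hGP : Measurable fun ω =>
        G.indicator (1 : ProbabilityMeasure S × (ℕ → S) → ℝ≥0∞) (P ω, ω) :=
      hGm.comp (hP.1.prodMk measurable_id)
    rw [lintegral_eq_zero_iff hGP] at h0
    filter_upwards [h0] with ω hω hnull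
    by_contra! hlt
    have hmem : (P ω, ω) ∈ G := ⟨hnull, hlt⟩
    simp [hmem] at hω
  have hall := ae_all_iff.2 fun q : ℚ => hq (Real.toNNReal q)
  filter_upwards [h, hall] with ω hω hω'
  by_contra! hlt
  obtain ⟨q, -, hq1, hq2⟩ := ENNReal.lt_iff_exists_rat_btwn.1 hlt
  refine absurd (hω' q ?_) (not_le.2 hq2)
  rw [measure_eq_zero_iff_ae_notMem]
  filter_upwards [hω] with ω' h1 h2
  exact absurd (hq1.trans h2) (not_lt.2 h1)

lemma dist₂_dirac_le [Nonempty S] {p : ℝ} (hp : 1 ≤ p) {Q : Measure (ProbabilityMeasure S)}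
    [IsProbabilityMeasure Q] (hQ : ∀ᵐ μ ∂Q, μ ∈ finiteMoment S p) (ν : WassersteinSpace S p) :
    dist₂ p (onWassersteinSpace p Q) (Measure.dirac ν) ≤
      (∫⁻ μ, measurableDist p μ ν.1 ^ p ∂Q) ^ (1 / p) := by
  have hfm := measurableSet_finiteMoment (S := S) hp
  have hemb : MeasurableEmbedding (Subtype.val : WassersteinSpace S p → ProbabilityMeasure S) :=
    MeasurableEmbedding.subtype_coe hfm
  set R : Measure (WassersteinSpace S p) := onWassersteinSpace p Q with hR
  have hmap : R.map Subtype.val = Q := by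
    rw [hR, onWassersteinSpace, hemb.map_comap, Subtype.range_coe]
    exact Measure.restrict_eq_self_of_ae_mem hQ
  have hRp : IsProbabilityMeasure R := by
    constructor
    rw [← Set.preimage_univ (f := Subtype.val), ← Measure.map_apply measurable_subtype_coe .univ,
      hmap, measure_univ]
  have hpair : Measurable fun μ : WassersteinSpace S p => (μ, ν) := by fun_prop
  have hγ : R.map (fun μ => (μ, ν)) ∈ couplings R (Measure.dirac ν) := by
    refine ⟨Measure.isProbabilityMeasure_map hpair.aemeasurable, ?_, ?_⟩
    · rw [Measure.map_map measurable_fst hpair]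
      exact Measure.map_id
    · rw [Measure.map_map measurable_snd hpair]
      have : (Prod.snd ∘ fun μ : WassersteinSpace S p => (μ, ν)) = fun _ => ν := rfl
      rw [this, Measure.map_const, measure_univ, one_smul]
  have hp0 : 0 ≤ 1 / p := by positivity
  refine (iInf₂_le _ hγ).trans (ENNReal.rpow_le_rpow ?_ hp0)
  -- This inequality holds for every integrand, so `dist₁` need not be known to be measurable on
  -- pairs.
  refine (lintegral_map_le _ _).trans_eq ?_
  have hD : Measurable fun μ : ProbabilityMeasure S => measurableDist p μ ν.1 ^ p :=
    ((measurable_measurableDist p).comp (measurable_id.prodMk measurable_const)).pow_const p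
  conv_rhs => rw [← hmap, lintegral_map hD measurable_subtype_coe]
  exact lintegral_congr fun μ => by rw [measurableDist_eq_dist₁ hp μ.2 ν.2]

end Transfer

end PosteriorWasserstein

/-! ### The main theorem -/

open PosteriorWasserstein

theorem mainTheorem4 {S : Type*} [MetricSpace S] [TopologicalSpace.SeparableSpace S]
    [MeasurableSpace S] [BorelSpace S] (hS : PosteriorWasserstein.IsRadonSpace S)
    (ρ : Measure (ℕ → S)) [IsProbabilityMeasure ρ] (hρ : PosteriorWasserstein.Exchangeable ρ)
    (P : (ℕ → S) → ProbabilityMeasure S) (hP : PosteriorWasserstein.IsDirectingMeasure ρ P)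
    (p : ℝ) (hp : 1 ≤ p)
    (hPp : ∀ᵐ ω ∂ρ, P ω ∈ PosteriorWasserstein.finiteMoment S p)
    (phat : ℕ → (ℕ → S) → PosteriorWasserstein.WassersteinSpace S p)
    (hphat : ∀ n ≥ 1, Measurable[PosteriorWasserstein.sampleSigma S n] (phat n))
    (post : (n : ℕ) → Kernel (Fin n → S) (ProbabilityMeasure S))
    (hpost : ∀ n ≥ 1, PosteriorWasserstein.IsPosterior ρ P n (post n))
    (b : ℕ → ℝ) (hb_pos : ∀ n ≥ 1, 0 < b n) (hb_mono : MonotoneOn b (Set.Ici 1))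
    (hb_lim : Tendsto b atTop atTop)
    (C Y : ProbabilityMeasure S → ℝ≥0)
    (hC : AEMeasurable (fun ω => C (P ω)) ρ) (hY : AEMeasurable (fun ω => Y (P ω)) ρ)
    (hmoment : ∀ᵐ ω ∂ρ, PosteriorWasserstein.UniformMomentBound p b phat (P ω) (C (P ω)))
    (has : ∀ᵐ ω ∂ρ, PosteriorWasserstein.AlmostSureBound p b phat (P ω) (Y (P ω)))
    (hCint : ∫⁻ ω, (C (P ω) : ℝ≥0∞) ∂ρ < ∞) :
    ∀ᵐ ω ∂ρ,
      limsup (fun n => ENNReal.ofReal (b n) *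
        PosteriorWasserstein.dist₂ p
          (PosteriorWasserstein.onWassersteinSpace p
            (post n (PosteriorWasserstein.sample n ω)))
          (Measure.dirac (phat n ω))) atTop ≤ (Y (P ω) : ℝ≥0∞) := by
  have : SecondCountableTopology S := UniformSpace.secondCountable_of_separable S
  have hp0 : 0 < p := by linarith
  obtain ⟨ω₀⟩ : Nonempty (ℕ → S) := nonempty_of_isProbabilityMeasure ρ
  have : Nonempty S := ⟨ω₀ 0⟩
  -- The measurable version of the distance is used. The value `0` at `n = 0` is a filler, since
  -- `phat 0` is not assumed measurable and the moment bound starts at `n = 1`.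
  let D : ℕ → ProbabilityMeasure S × (ℕ → S) → ℝ≥0∞ := fun n z =>
    if n = 0 then 0 else ENNReal.ofReal (b n) * measurableDist p z.1 (phat n z.2).1
  have hphat' : ∀ n ≥ 1, Measurable[sampleSigma S n] fun ω => (phat n ω).1 := fun n hn =>
    measurable_subtype_coe.comp (hphat n hn)
  have hD : ∀ n, Measurable (D n) := by
    intro n
    by_cases hn : n = 0
    · simp [D, hn]
    · simp only [D, hn, if_false]
      have hm : Measurable fun ω => (phat n ω).1 :=
        (hphat' n (Nat.one_le_iff_ne_zero.2 hn)).mono (sampleSigma_le n) le_rfl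
      have hpair : Measurable fun z : ProbabilityMeasure S × (ℕ → S) => (z.1, (phat n z.2).1) :=
        measurable_fst.prodMk (hm.comp measurable_snd)
      exact ((measurable_measurableDist p).comp hpair).const_mul _
  have hDdist : ∀ μ ∈ finiteMoment S p, ∀ n ≥ 1, ∀ ω,
      D n (μ, ω) = ENNReal.ofReal (b n) * dist₁ p μ (phat n ω).1 := by
    intro μ hμ n hn ω
    simp only [D, Nat.one_le_iff_ne_zero.1 hn, if_false]
    rw [measurableDist_eq_dist₁ hp hμ (phat n ω).2]
  have hDpad : ∀ n ω μ, D n (μ, padSample (ω₀ 0) n (sample n ω)) = D n (μ, ω) := by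
    intro n ω μ
    by_cases hn : n = 0
    · simp [D, hn]
    · simp only [D, hn, if_false]
      rw [eq_of_sample_eq (hphat' n (Nat.one_le_iff_ne_zero.2 hn)) (sample_padSample _ n _)]
  -- Padding the sample to a sequence exhibits `D n` as a function of the sample and the measure,
  -- because the estimator ignores later coordinates.
  let F : (n : ℕ) → (Fin n → S) × ProbabilityMeasure S → ℝ≥0∞ := fun n z =>
    D n (z.2, padSample (ω₀ 0) n z.1) ^ p
  have hF : ∀ n, Measurable (F n) := fun n =>
    ((hD n).comp (measurable_snd.prodMk
      ((measurable_padSample (ω₀ 0) n).comp measurable_fst))).pow_const p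
  have hFD : ∀ n ω μ, F n (sample n ω, μ) = D n (μ, ω) ^ p := fun n ω μ => by
    simp only [F, hDpad]
  -- The domination for Hunt's lemma: by de Finetti's theorem the integral is a mean of i.i.d.
  -- moments, each at most `C (P ω)`.
  have hint : ∫⁻ ω, ⨆ n, F n (sample n ω, P ω) ∂ρ ≠ ∞ := by
    have hsup : Measurable fun z : ProbabilityMeasure S × (ℕ → S) => (⨆ n, D n z) ^ p :=
      (Measurable.iSup hD).pow_const p
    refine ne_top_of_le_ne_top hCint.ne ?_
    calc ∫⁻ ω, ⨆ n, F n (sample n ω, P ω) ∂ρ ≤ ∫⁻ ω, (⨆ n, D n (P ω, ω)) ^ p ∂ρ := by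
          refine lintegral_mono fun ω => iSup_le fun n => ?_
          rw [hFD]
          exact ENNReal.rpow_le_rpow (le_iSup (fun n => D n (P ω, ω)) n) hp0.le
      _ = ∫⁻ ω, ∫⁻ ω', (⨆ n, D n (P ω, ω')) ^ p ∂(iidLaw (P ω)) ∂ρ :=
          lintegral_directing_eq hρ hP hsup
      _ ≤ _ := by
          refine lintegral_mono_ae ?_
          filter_upwards [hmoment, hPp] with ω hω hμ
          refine le_trans (lintegral_mono fun ω' => ENNReal.rpow_le_rpow ?_ hp0.le) hω
          refine iSup_le fun n => ?_
          by_cases hn : n = 0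
          · simp [D, hn]
          · have hn' := Nat.one_le_iff_ne_zero.2 hn
            rw [hDdist _ hμ n hn']
            exact le_iSup₂ (f := fun n (_ : n ≥ 1) =>
              ENNReal.ofReal (b n) * dist₁ p (P ω) (phat n ω').1) n hn'
  have hbound : ∀ᵐ ω ∂ρ, limsup (fun n => D n (P ω, ω)) atTop ≤ Y (P ω) := by
    refine ae_le_of_ae_iidLaw_le hρ hP (L := fun z => limsup (fun n => D n z) atTop)
      (Y := fun μ => Y μ) (Measurable.limsup hD) ?_
    filter_upwards [has, hPp] with ω hω hμ
    filter_upwards [hω] with ω' hω'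
    refine le_of_eq_of_le (limsup_congr ?_) hω'
    filter_upwards [eventually_ge_atTop 1] with n hn
    exact hDdist _ hμ n hn ω'
  have hmem : ∀ᵐ ω ∂ρ, ∀ n ≥ 1, ∀ᵐ μ ∂(post n (sample n ω)), μ ∈ finiteMoment S p := by
    simp only [ae_all_iff]
    exact fun n hn => (hpost n hn).ae_mem hP.1 (measurableSet_finiteMoment hp) hPp
  filter_upwards [hbound, hmem, limsup_posterior_lintegral_le hP.1 hpost hF hint]
    with ω hY hfm hlim
  refine le_trans ?_ hY
  -- The power `1 / p` is an order isomorphism of `[0, ∞]`, so it commutes with limsup.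
  have hiso : ∀ u : ℕ → ℝ≥0∞, limsup u atTop ^ (1 / p) = limsup (fun n => u n ^ (1 / p)) atTop :=
    fun u => (ENNReal.orderIsoRpow (1 / p) (by positivity)).limsup_apply
  have hlim' := ENNReal.rpow_le_rpow hlim (z := 1 / p) (by positivity)
  rw [hiso, hiso] at hlim'
  simp only [hFD, ← ENNReal.rpow_mul, mul_one_div_cancel hp0.ne', ENNReal.rpow_one] at hlim'
  refine le_trans (limsup_le_limsup ?_) hlim'
  filter_upwards [eventually_ge_atTop 1] with n hn
  have := (hpost n hn).1
  have hDn : ∀ μ, D n (μ, ω) = ENNReal.ofReal (b n) * measurableDist p μ (phat n ω).1 := fun μ => by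
    simp only [D, Nat.one_le_iff_ne_zero.1 hn, if_false]
  simp only [hDn, ENNReal.mul_rpow_of_nonneg _ _ hp0.le]
  rw [lintegral_const_mul' _ _ (ENNReal.rpow_ne_top_of_nonneg hp0.le ENNReal.ofReal_ne_top),
    ENNReal.mul_rpow_of_nonneg _ _ (by positivity : 0 ≤ 1 / p), ← ENNReal.rpow_mul,
    mul_one_div_cancel hp0.ne', ENNReal.rpow_one]
  gcongr
  exact dist₂_dirac_le hp (hfm n hn) (phat n ω)
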